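/- Notation. $\mathbb N=\{1,2,\dots\}$. For $p\in[1,\infty]$, $\|\cdot\|_p$ is the $\ell_p$-norm on $\mathbb R^m$, and $1/\infty=0$. A ReLU network with input dimension $m$ and output dimension $n$ is a tuple $\Phi=((W_1,b_1),\dots,(W_N,b_N))$ with $N\in\mathbb N$, $W_i\in\mathbb R^{\ell_i\times\ell_{i-1}}$, $b_i\in\mathbb R^{\ell_i}$, $\ell_0=m$, $\ell_N=n$ and all $\ell_i\in\mathbb N$. Its realization is $\mathcal R(\Phi)=A_N\circ\mathfrak r\circ A_{N-1}\circ\cdots\circ\mathfrak r\circ A_1:\mathbb R^m\to\mathbb R^n$, where $A_i(x)=W_ix+b_i$ and $\mathfrak r$ is the componentwise map $t\mapsto\max\{t,0\}$, and its number of parameters is $\mathcal P(\Phi)=\sum_{i=1}^N\ell_i(\ell_{i-1}+1)$. For $D\subseteq\mathbb R^m$, $f\in C(D,\mathbb R^n)$ and $L,\varepsilon\in[0,\infty)$ let $\operatorname{Cost}_p(f,L,\varepsilon)\in\mathbb N\cup\{\infty\}$ be the minimum of $\mathcal P(\Phi)$ over all ReLU networks $\Phi$ with input dimension $m$ and output dimension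 $n$ such that $\|\mathcal R(\Phi)(x)-f(x)\|_p\le\varepsilon$ for all $x\in D$ and $\|\mathcal R(\Phi)(x)-\mathcal R(\Phi)(y)\|_p\le L\|x-y\|_p$ for all $x,y\in D$; it is $\infty$ if there is no such network. For $k,d\in\mathbb N$, real $a<b$ and $L\in[0,\infty)$ let $\mathscr P_{k,p}([a,b]^d,L)$ be the set of all functions $f:[a,b]^d\to\mathbb R^n$, $n\in\mathbb N$, of the form $f(x_1,\dots,x_n)=(f_1(x_1),\dots,f_n(x_n))$, where $x_i\in[a,b]^{d_i}$, $d_i\in\mathbb N$, $d_i\le k$, $d_1+\dots+d_n=d$, and $f_i:[a,b]^{d_i}\to\mathbb R$ satisfies $|f_i(x)-f_i(y)|\le L\|x-y\|_p$ for all $x,y\in[a,b]^{d_i}$. Corollary 3.5. Let $k\in\mathbb N$. Then there exists $K\in\mathbb N$ such that for all $d\in\mathbb N$, $a\in\mathbb R$, $b\in(a,\infty)$, $p\in[1,\infty]$, $L\in[0,\infty)$, $\varepsilon\in(0,1]$ and $f\in\mathscr P_{k,p}([a,b]^d,L)$, $$\operatorname{Cost}_p\bigl(f,k^{1-1/p}L,\varepsilon\bigr)\le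 K\,d^{2k+3}\,\bigl(\max\{L(b-a),1\}\bigr)^{2k}\,\varepsilon^{-2k}.$$ -/

import Mathlib

open scoped ENNReal

namespace DNN

/-- The `ℓ_p`-norm of `x ∈ ℝ^d` for `p ∈ [1, ∞]`: `(∑ |x_i|^p)^(1/p)` for `p < ∞` and
`max |x_i|` for `p = ∞`. -/
noncomputable def lpNorm (p : ℝ≥0∞) {d : ℕ} (x : Fin d → ℝ) : ℝ :=
  ‖(WithLp.toLp p x : PiLp p (fun _ : Fin d => ℝ))‖

/-- The multidimensional rectified linear unit. -/
noncomputable def relu {d : ℕ} (x : Fin d → ℝ) : Fin d → ℝ := fun i => max (x i) 0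

/-- `Net m n` is the set of fully connected feedforward networks
`((W_1, b_1), …, (W_L, b_L))`, `L ≥ 1`, with input dimension `ℓ_0 = m` and output dimension
`ℓ_L = n`; all layer dimensions are positive. A network is given by its layers one after the
other: `last W b` is the network with the single layer `(W, b)` and `cons W b Φ` is the network
with first layer `(W, b)` followed by the layers of `Φ`. -/
inductive Net : ℕ → ℕ → Type
  | last {m n : ℕ} (hm : 0 < m) (hn : 0 < n)
      (W : Matrix (Fin n) (Fin m) ℝ) (b : Fin n → ℝ) : Net m n
  | cons {m l n : ℕ} (hm : 0 < m)
      (W : Matrix (Fin l) (Fin m) ℝ) (b : Fin l → ℝ) (Φ : Net l n) : Net m n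

/-- The realization: affine layer maps `x ↦ W x + b`, with the activation between
consecutive layers and none after the last layer. -/
noncomputable def Net.realize : {m n : ℕ} → Net m n → (Fin m → ℝ) → (Fin n → ℝ)
  | _, _, .last _ _ W b => fun x => W.mulVec x + b
  | _, _, .cons _ W b Φ => fun x => Φ.realize (relu (W.mulVec x + b))

/-- The number of parameters `∑ ℓ_i (ℓ_{i-1} + 1)`. -/
def Net.params : {m n : ℕ} → Net m n → ℕ
  | m, n, .last _ _ _ _ => n * (m + 1)
  | m, _, .cons (l := l) _ _ _ Φ => l * (m + 1) + Φ.params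

/-- The approximation cost of `f ∈ C(D, ℝ^n)`: the least number of parameters of a network
whose realization is `ε`-close to `f` on `D` and `L`-Lipschitz on `D`, both with respect to the
`ℓ_p`-norm; it is `∞` if there is no such network. -/
noncomputable def cost (p : ℝ≥0∞) {m n : ℕ} {D : Set (Fin m → ℝ)} (f : C(D, Fin n → ℝ))
    (L ε : ℝ) : ℕ∞ :=
  sInf {N : ℕ∞ | ∃ Φ : Net m n, N = (Φ.params : ℕ∞) ∧
    (∀ x : D, lpNorm p (Φ.realize x - f x) ≤ ε) ∧
    (∀ x y : D, lpNorm p (Φ.realize x - Φ.realize y) ≤ L * lpNorm p (x.1 - y.1))}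

/-- The hypercube `[a, b]^d`. -/
def cube (a b : ℝ) (d : ℕ) : Set (Fin d → ℝ) := {x | ∀ i, x i ∈ Set.Icc a b}

/-- For `d = d_1 + ⋯ + d_n` and `x = (x_1, …, x_n) ∈ ℝ^d` with `x_i ∈ ℝ^{d_i}` (consecutive
blocks of coordinates), the block `x_i`. -/
def block {n d : ℕ} {ds : Fin n → ℕ} (hd : ∑ i, ds i = d) (x : Fin d → ℝ) (i : Fin n) :
    Fin (ds i) → ℝ :=
  fun j => x (Fin.cast hd (finSigmaFinEquiv ⟨i, j⟩))

theorem block_mem_cube {a b : ℝ} {n d : ℕ} {ds : Fin n → ℕ} (hd : ∑ i, ds i = d)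
    {x : Fin d → ℝ} (hx : x ∈ cube a b d) (i : Fin n) : block hd x i ∈ cube a b (ds i) :=
  fun _ => hx _

/-- The parallelization `g_1 □ ⋯ □ g_n : [a, b]^d → ℝ^n` of `g_i : [a, b]^{d_i} → ℝ`, where
`d = d_1 + ⋯ + d_n`. -/
def parallelization {a b : ℝ} {n d : ℕ} {ds : Fin n → ℕ} (hd : ∑ i, ds i = d)
    (g : (i : Fin n) → cube a b (ds i) → ℝ) : cube a b d → Fin n → ℝ :=
  fun x i => g i ⟨block hd x i, block_mem_cube hd x.2 i⟩

/-- The members with values in `ℝ^n` of the class of all parallelizations on `[a, b]^d` of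
functions of at least one and at most `k` variables that are `L`-Lipschitz with respect to the
`ℓ_p`-norm. -/
def lipParallel (k : ℕ) (p : ℝ≥0∞) (a b : ℝ) (d : ℕ) (L : ℝ) (n : ℕ) :
    Set C(cube a b d, Fin n → ℝ) :=
  {f | 0 < n ∧ ∃ (ds : Fin n → ℕ) (hd : ∑ i, ds i = d) (g : (i : Fin n) → cube a b (ds i) → ℝ),
    (∀ i, 0 < ds i) ∧ (∀ i, ds i ≤ k) ∧
    (∀ i, ∀ x y : cube a b (ds i),
      |g i x - g i y| ≤ L * lpNorm p (x.1 - y.1)) ∧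
    (f : cube a b d → Fin n → ℝ) = parallelization hd g}

end DNN

namespace DNN

/-! Since the `ℓ_p`-norm is at most the `ℓ_1`-norm, each component `g_i` is `L`-Lipschitz for `ℓ_1`.
Hence the maximum of the cones `g_i(y) - L‖x_i - y‖_1` over grid points `y` is `L`-Lipschitz for
`ℓ_1`, lies below `g_i`, and misses it by at most `2L` times the grid distance. Hölder on blocks of
at most `k` coordinates turns the `ℓ_1`-constant `L` into `k^(1-1/p) L`
(`sum_abs_le_rpow_mul_lpNorm`, `lpNorm_le_mul_lpNorm_of_block`).

All blocks share one list of `N^k` apexes (`exists_list_grid`), and a network of width `O(d)`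
processes them one at a time, two layers per apex (`exists_isRealizable_coneMax`). This costs `O(d^2
N^k)` parameters. Accuracy `ε/d` per component suffices, so `N` is of order `k d max(L(b-a), 1) /
ε`. -/

/-- `F` is, for every enumeration of its finite index types, the realization of a network with
`N` parameters. -/
def IsRealizable {κ ι : Type} (N : ℕ) (F : (κ → ℝ) → ι → ℝ) : Prop :=
  ∀ (m n : ℕ) (e : κ ≃ Fin m) (e' : ι ≃ Fin n),
    ∃ Φ : Net m n, Φ.params = N ∧ ∀ x, Φ.realize (x ∘ e.symm) = F x ∘ e'.symm

/-! ### Networks with layers indexed by arbitrary finite types -/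

section Realizable

variable {κ ι ι' : Type}

theorem toMatrix'_mulVec_reindex {m n : ℕ} (A : (κ → ℝ) →ₗ[ℝ] ι → ℝ) (e : κ ≃ Fin m)
    (e' : ι ≃ Fin n) (x : κ → ℝ) :
    (LinearMap.toMatrix' (LinearMap.funLeft ℝ ℝ e'.symm ∘ₗ A ∘ₗ LinearMap.funLeft ℝ ℝ e)).mulVec
      (x ∘ e.symm) = A x ∘ e'.symm := by
  have hx : (x ∘ e.symm) ∘ e = x := by ext; simp
  rw [LinearMap.toMatrix'_mulVec]
  ext i
  simp only [LinearMap.comp_apply, LinearMap.funLeft_apply, Function.comp_apply]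
  exact congrArg (fun z => A z (e'.symm i)) hx

variable [Fintype κ] [Fintype ι]

theorem isRealizable_affine [Nonempty κ] [Nonempty ι] (A : (κ → ℝ) →ₗ[ℝ] ι → ℝ) (b : ι → ℝ) :
    IsRealizable (Fintype.card ι * (Fintype.card κ + 1)) (fun x => A x + b) := by
  intro m n e e'
  have hm : Fintype.card κ = m := by simpa using Fintype.card_congr e
  have hn : Fintype.card ι = n := by simpa using Fintype.card_congr e'
  refine ⟨.last (hm ▸ Fintype.card_pos) (hn ▸ Fintype.card_pos) (LinearMap.toMatrix'
    (LinearMap.funLeft ℝ ℝ e'.symm ∘ₗ A ∘ₗ LinearMap.funLeft ℝ ℝ e)) (b ∘ e'.symm), ?_, ?_⟩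
  · simp [Net.params, hm, hn]
  · intro x
    simp only [Net.realize]
    rw [toMatrix'_mulVec_reindex]
    rfl

theorem IsRealizable.comp_layer [Nonempty κ] {N : ℕ} {F : (ι → ℝ) → ι' → ℝ}
    (hF : IsRealizable N F) (A : (κ → ℝ) →ₗ[ℝ] ι → ℝ) (b : ι → ℝ) :
    IsRealizable (Fintype.card ι * (Fintype.card κ + 1) + N)
      (fun x => F (fun i => max (A x i + b i) 0)) := by
  intro m n e e'
  have hm : Fintype.card κ = m := by simpa using Fintype.card_congr e
  obtain ⟨Φ, hΦ, hΦF⟩ := hF _ _ (Fintype.equivFin ι) e'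
  refine ⟨.cons (hm ▸ Fintype.card_pos) (LinearMap.toMatrix'
    (LinearMap.funLeft ℝ ℝ (Fintype.equivFin ι).symm ∘ₗ A ∘ₗ LinearMap.funLeft ℝ ℝ e))
    (b ∘ (Fintype.equivFin ι).symm) Φ, ?_, ?_⟩
  · simp [Net.params, hm, hΦ]
  · intro x
    simp only [Net.realize]
    rw [toMatrix'_mulVec_reindex, ← hΦF]
    rfl

end Realizable

/-! ### Maxima of cones as networks -/

section MaxConvolution

variable {d n : ℕ} {ds : Fin n → ℕ}

/-- The cone `x ↦ c_i - L ∑_j |x_{i,j} - y_{i,j}|` with apex `(y, c)`, where `e i j` is the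
position of the `j`-th coordinate of the `i`-th block. -/
noncomputable def cone (e : (i : Fin n) → Fin (ds i) → Fin d) (L : ℝ)
    (h : (Fin d → ℝ) × (Fin n → ℝ)) (x : Fin d → ℝ) (i : Fin n) : ℝ :=
  h.2 i - L * ∑ j, |x (e i j) - h.1 (e i j)|

/-- The maximum of `r` and of the cones with apexes in the list `H`. -/
noncomputable def coneMax (e : (i : Fin n) → Fin (ds i) → Fin d) (L : ℝ) (x : Fin d → ℝ)
    (i : Fin n) : List ((Fin d → ℝ) × (Fin n → ℝ)) → ℝ → ℝ
  | [], r => r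
  | h :: H, r => coneMax e L x i H (max r (cone e L h x i))

theorem coneMax_le_iff (e : (i : Fin n) → Fin (ds i) → Fin d) (L : ℝ) (x : Fin d → ℝ)
    (i : Fin n) (H : List ((Fin d → ℝ) × (Fin n → ℝ))) (r u : ℝ) :
    coneMax e L x i H r ≤ u ↔ r ≤ u ∧ ∀ h ∈ H, cone e L h x i ≤ u := by
  induction H generalizing r with
  | nil => simp [coneMax]
  | cons h H ih => simp [coneMax, ih, and_assoc]

/-- The number of parameters of the layers that update the maximum by one cone. -/
def stepParams (d n : ℕ) : ℕ :=
  (d + (n + d)) * (d + (n + n) + 1) + (d + (n + n)) * (d + (n + d) + 1)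

/-- The state is `(x - a, r, s)` with current maximum `B + r + s`. All entries are nonnegative, so
ReLU carries them unchanged, and `max M c = M + max (c - M) 0` performs the update. -/
theorem exists_isRealizable_coneMax (hd : 0 < d) (hn : 0 < n)
    (e : (i : Fin n) → Fin (ds i) → Fin d) (L a : ℝ) (B : Fin n → ℝ)
    (H : List ((Fin d → ℝ) × (Fin n → ℝ))) :
    ∃ F : (Fin d ⊕ (Fin n ⊕ Fin n) → ℝ) → Fin n → ℝ,
      IsRealizable (n * (d + (n + n) + 1) + H.length * stepParams d n) F ∧
      ∀ (x : Fin d → ℝ) (r s : Fin n → ℝ), (∀ l, a ≤ x l) → (∀ i, 0 ≤ r i) → (∀ i, 0 ≤ s i) →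
        ∀ i, F (Sum.elim (fun l => x l - a) (Sum.elim r s)) i =
          coneMax e L x i H (B i + r i + s i) := by
  have : Nonempty (Fin d) := ⟨⟨0, hd⟩⟩
  have : Nonempty (Fin n) := ⟨⟨0, hn⟩⟩
  induction H with
  | nil =>
    have h0 := isRealizable_affine (κ := Fin d ⊕ (Fin n ⊕ Fin n))
      (LinearMap.pi fun i => LinearMap.proj (.inr (.inl i)) + LinearMap.proj (.inr (.inr i))) B
    refine ⟨_, by simpa using h0, ?_⟩
    intro x r s _ _ _ i
    simp [coneMax]
    ring
  | cons h H ih =>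
    obtain ⟨F, hF, hFx⟩ := ih
    -- Second layer of the step: the new `s` is the positive part of cone minus current maximum,
    -- using `|t| = 2 max t 0 - t`.
    have h2 := hF.comp_layer (κ := Fin d ⊕ (Fin n ⊕ Fin d))
      (LinearMap.pi (Sum.elim (fun l => LinearMap.proj (.inl l))
        (Sum.elim (fun i => LinearMap.proj (.inr (.inl i)))
          (fun i => -(L • ∑ j, ((2 : ℝ) • LinearMap.proj (.inr (.inr (e i j)))
            - LinearMap.proj (.inl (e i j)))) - LinearMap.proj (.inr (.inl i))))))
      (Sum.elim 0 (Sum.elim 0 (fun i => h.2 i - B i - L * ∑ j, (h.1 (e i j) - a))))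
    -- First layer of the step: merges `r + s` and forms the positive parts of `x - h.1`.
    have h1 := h2.comp_layer (κ := Fin d ⊕ (Fin n ⊕ Fin n))
      (LinearMap.pi (Sum.elim (fun l => LinearMap.proj (.inl l))
        (Sum.elim (fun i => LinearMap.proj (.inr (.inl i)) + LinearMap.proj (.inr (.inr i)))
          (fun l => LinearMap.proj (.inl l)))))
      (Sum.elim 0 (Sum.elim 0 (fun l => a - h.1 l)))
    have hN : (d + (n + d)) * (d + (n + n) + 1) + ((d + (n + n)) * (d + (n + d) + 1) +
        (n * (d + (n + n) + 1) + H.length * stepParams d n)) =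
        n * (d + (n + n) + 1) + (h :: H).length * stepParams d n := by
      simp only [stepParams, List.length_cons]
      ring
    simp only [Fintype.card_sum, Fintype.card_fin, hN] at h1
    refine ⟨_, h1, ?_⟩
    intro x r s hx hr hs i
    rw [coneMax]
    have key : B i + (r i + s i) + max (h.2 i - B i - L * ∑ j, |x (e i j) - h.1 (e i j)|
        - (r i + s i)) 0 = max (B i + r i + s i) (cone e L h x i) := by
      rw [cone, ← max_add_add_left, max_comm]
      congr 1 <;> ring
    rw [← key]
    refine Eq.trans ?_ (hFx x (fun i => r i + s i) (fun i =>
      max (h.2 i - B i - L * ∑ j, |x (e i j) - h.1 (e i j)| - (r i + s i)) 0) hx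
      (fun i => add_nonneg (hr i) (hs i)) (fun i => le_max_right _ _) i)
    congr 1
    funext z
    rcases z with l | i | i
    · simp [hx l]
    · simp [add_nonneg (hr i) (hs i)]
    · have habs : ∀ j, |x (e i j) - h.1 (e i j)| =
          2 * max (x (e i j) - a + (a - h.1 (e i j))) 0 - max (x (e i j) - a) 0
            + (h.1 (e i j) - a) := by
        intro j
        rw [max_eq_left (sub_nonneg.2 (hx _))]
        rcases le_total (x (e i j)) (h.1 (e i j)) with hj | hj
        · rw [abs_of_nonpos (by linarith), max_eq_right (by linarith)]; ring
        · rw [abs_of_nonneg (by linarith), max_eq_left (by linarith)]; ring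
      simp [add_nonneg (hr i) (hs i), habs, Finset.sum_add_distrib]
      congr 1
      ring

theorem exists_net_coneMax (hd : 0 < d) (hn : 0 < n)
    (e : (i : Fin n) → Fin (ds i) → Fin d) (L a : ℝ) (B : Fin n → ℝ)
    (H : List ((Fin d → ℝ) × (Fin n → ℝ))) :
    ∃ Φ : Net d n, Φ.params = (d + (n + n)) * (d + 1) +
        (n * (d + (n + n) + 1) + H.length * stepParams d n) ∧
      ∀ x : Fin d → ℝ, (∀ l, a ≤ x l) → ∀ i, Φ.realize x i = coneMax e L x i H (B i) := by
  have : Nonempty (Fin d) := ⟨⟨0, hd⟩⟩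
  obtain ⟨F, hF, hFx⟩ := exists_isRealizable_coneMax hd hn e L a B H
  obtain ⟨Φ, hΦ, hΦx⟩ := hF.comp_layer (κ := Fin d)
    (LinearMap.pi (Sum.elim (fun l => LinearMap.proj l) 0))
    (Sum.elim (fun _ => -a) 0) _ _ (Equiv.refl _) (Equiv.refl _)
  refine ⟨Φ, by simpa using hΦ, fun x hx i => ?_⟩
  have h0 := hFx x 0 0 hx (fun _ => le_rfl) (fun _ => le_rfl) i
  simp only [Pi.zero_apply, add_zero] at h0
  rw [← h0]
  have := congrFun (hΦx x) i
  simp only [Equiv.refl_symm, Equiv.coe_refl, Function.comp_id] at this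
  rw [this]
  congr 1
  funext z
  rcases z with l | i | i
  · simpa [← sub_eq_add_neg] using hx l
  · simp
  · simp

end MaxConvolution

/-! ### Inequalities between `ℓ_p`-norms -/

theorem lpNorm_top {d : ℕ} (x : Fin d → ℝ) : lpNorm ∞ x = ‖x‖ := by
  simp [lpNorm]

theorem lpNorm_eq_sum {p : ℝ≥0∞} (hp : 0 < p.toReal) {d : ℕ} (x : Fin d → ℝ) :
    lpNorm p x = (∑ i, |x i| ^ p.toReal) ^ (1 / p.toReal) := by
  simp [lpNorm, PiLp.norm_eq_sum hp]

theorem norm_toLp_le_of_forall_le {p : ℝ≥0∞} [Fact (1 ≤ p)] {ι : Type*} [Fintype ι]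
    {E F : ι → Type*} [∀ i, SeminormedAddCommGroup (E i)] [∀ i, SeminormedAddCommGroup (F i)]
    (x : PiLp p E) (y : PiLp p F) (h : ∀ i, ‖x i‖ ≤ ‖y i‖) : ‖x‖ ≤ ‖y‖ := by
  have h1 : 1 ≤ p := Fact.out
  induction p using ENNReal.recTopCoe with
  | top =>
    rw [PiLp.norm_eq_ciSup, PiLp.norm_eq_ciSup]
    exact ciSup_mono (Set.finite_range _).bddAbove h
  | coe p =>
    have hp : 0 < (p : ℝ≥0∞).toReal := by
      have : (1 : NNReal) ≤ p := by exact_mod_cast h1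
      simpa using lt_of_lt_of_le one_pos this
    rw [PiLp.norm_eq_sum hp, PiLp.norm_eq_sum hp]
    gcongr with i
    exact h i

theorem lpNorm_le_sum_abs (p : ℝ≥0∞) [Fact (1 ≤ p)] {d : ℕ} (x : Fin d → ℝ) :
    lpNorm p x ≤ ∑ i, |x i| := by
  have h : (WithLp.toLp p x : PiLp p (fun _ : Fin d => ℝ)) =
      ∑ i, PiLp.single p i (x i) := by
    ext j
    simp
  rw [lpNorm, h]
  refine (norm_sum_le _ _).trans (le_of_eq ?_)
  simp

/-- Hölder's inequality between the `ℓ_1`- and the `ℓ_p`-norm. -/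
theorem sum_abs_le_rpow_mul_lpNorm (p : ℝ≥0∞) (h1 : 1 ≤ p) {m k : ℕ} (hk : 0 < k)
    (hmk : m ≤ k) (x : Fin m → ℝ) :
    ∑ i, |x i| ≤ (k : ℝ) ^ (1 - (p⁻¹).toReal) * lpNorm p x := by
  induction p using ENNReal.recTopCoe with
  | top =>
    rw [lpNorm_top]
    calc ∑ i, |x i| ≤ ∑ _i : Fin m, ‖x‖ := Finset.sum_le_sum fun i _ => norm_le_pi_norm x i
      _ = m * ‖x‖ := by simp
      _ ≤ k * ‖x‖ := by gcongr
      _ = _ := by simp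
  | coe p =>
    have h1' : (1 : ℝ) ≤ p := by exact_mod_cast h1
    have hp : (0 : ℝ) < p := by linarith
    have hk1 : (1 : ℝ) ≤ k := by exact_mod_cast hk
    have hS : 0 ≤ ∑ i, |x i| := Finset.sum_nonneg fun i _ => abs_nonneg _
    have hSp : 0 ≤ ∑ i, |x i| ^ (p : ℝ) := Finset.sum_nonneg fun i _ => by positivity
    rw [lpNorm_eq_sum (by simpa using hp)]
    have key := Real.rpow_sum_le_const_mul_sum_rpow (Finset.univ : Finset (Fin m)) x h1'
    simp only [Finset.card_univ, Fintype.card_fin] at key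
    have key2 : (∑ i, |x i|) ^ (p : ℝ) ≤ (k : ℝ) ^ ((p : ℝ) - 1) * ∑ i, |x i| ^ (p : ℝ) := by
      refine key.trans ?_
      gcongr
    have := Real.rpow_le_rpow (by positivity) key2 (one_div_nonneg.2 hp.le)
    rw [← Real.rpow_mul hS, mul_one_div_cancel hp.ne', Real.rpow_one,
      Real.mul_rpow (by positivity) hSp, ← Real.rpow_mul (by positivity)] at this
    have hp0 : p ≠ 0 := by rintro rfl; simp at hp
    have hexp : ((p : ℝ) - 1) * (1 / p) = 1 - ((p : ℝ≥0∞)⁻¹).toReal := by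
      rw [← ENNReal.coe_inv hp0, ENNReal.coe_toReal, NNReal.coe_inv]
      field_simp
    rwa [hexp] at this

/-- The `ℓ_p`-norm of `x` is the `ℓ_p`-norm of the vector of block norms, and `ℓ_p`-norms are
monotone in the entries. -/
theorem lpNorm_le_mul_lpNorm_of_block {p : ℝ≥0∞} (h1 : 1 ≤ p) {n d : ℕ} {ds : Fin n → ℕ}
    (hd : ∑ i, ds i = d) {C : ℝ} (hC : 0 ≤ C) (v : Fin n → ℝ) (x : Fin d → ℝ)
    (h : ∀ i, |v i| ≤ C * lpNorm p (block hd x i)) : lpNorm p v ≤ C * lpNorm p x := by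
  have : Fact (1 ≤ p) := ⟨h1⟩
  subst hd
  have hx : lpNorm p x = ‖(WithLp.toLp p fun i => WithLp.toLp p (block rfl x i) :
      PiLp p fun i : Fin n => PiLp p fun _ : Fin (ds i) => ℝ)‖ := by
    rw [lpNorm, ← (LinearIsometryEquiv.piLpCongrLeft p ℝ ℝ finSigmaFinEquiv.symm).norm_map,
      ← (LinearIsometryEquiv.piLpCurry ℝ p (fun (i : Fin n) (_ : Fin (ds i)) => ℝ)).norm_map]
    rfl
  have hsmul : C * lpNorm p x = ‖C • (WithLp.toLp p fun i => WithLp.toLp p (block rfl x i) :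
      PiLp p fun i : Fin n => PiLp p fun _ : Fin (ds i) => ℝ)‖ := by
    rw [norm_smul, hx, Real.norm_of_nonneg hC]
  rw [hsmul, lpNorm]
  refine norm_toLp_le_of_forall_le _ _ fun i => ?_
  rw [PiLp.smul_apply, norm_smul, Real.norm_of_nonneg hC]
  exact h i

/-! ### Grids and approximation by cones -/

/-- The lower-left corners of the cells of the uniform subdivision of `[a, b]` into `N` intervals. -/
noncomputable def gridPoint (a b : ℝ) (N : ℕ) (t : Fin N) : ℝ := a + t * ((b - a) / N)

theorem gridPoint_mem_Icc {a b : ℝ} (hab : a < b) {N : ℕ} (t : Fin N) :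
    gridPoint a b N t ∈ Set.Icc a b := by
  have hN : (0 : ℝ) < N := by exact_mod_cast t.pos
  have ht : (t : ℝ) ≤ N := by exact_mod_cast t.is_lt.le
  have hba : 0 < b - a := sub_pos.2 hab
  refine ⟨le_add_of_nonneg_right (by positivity), ?_⟩
  calc gridPoint a b N t ≤ a + N * ((b - a) / N) := by unfold gridPoint; gcongr
    _ = b := by field_simp; ring

theorem exists_abs_sub_gridPoint_le {a b : ℝ} (hab : a < b) {N : ℕ} (hN : 0 < N) {x : ℝ}
    (hx : x ∈ Set.Icc a b) : ∃ t : Fin N, |x - gridPoint a b N t| ≤ (b - a) / N := by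
  have hN' : (0 : ℝ) < N := by exact_mod_cast hN
  have hba : 0 < b - a := sub_pos.2 hab
  set h : ℝ := (b - a) / N with hh
  have hpos : 0 < h := by positivity
  have hNh : N * h = b - a := by rw [hh]; field_simp
  have hu : 0 ≤ (x - a) / h := div_nonneg (sub_nonneg.2 hx.1) hpos.le
  by_cases hlt : ⌊(x - a) / h⌋₊ < N
  · refine ⟨⟨_, hlt⟩, ?_⟩
    have h1 := (le_div_iff₀ hpos).1 (Nat.floor_le hu)
    have h2 := (div_lt_iff₀ hpos).1 (Nat.lt_floor_add_one ((x - a) / h))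
    rw [gridPoint, ← hh, abs_le]
    constructor <;> linarith
  -- Only `x = b` is left; it belongs to the last cell.
  · refine ⟨⟨N - 1, by omega⟩, ?_⟩
    have h1 := (le_div_iff₀ hpos).1 ((Nat.le_floor_iff hu).1 (not_lt.1 hlt))
    have hc : ((N - 1 : ℕ) : ℝ) = N - 1 := by push_cast [hN]; ring
    rw [gridPoint, ← hh, hc, abs_le]
    have := hx.2
    constructor <;> linarith

theorem exists_list_grid {a b : ℝ} (hab : a < b) {n d k : ℕ} {ds : Fin n → ℕ}
    (hd : ∑ i, ds i = d) (hds : ∀ i, ds i ≤ k) {N : ℕ} (hN : 0 < N) :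
    ∃ Y : List (cube a b d), Y.length = N ^ k ∧
      ∀ x ∈ cube a b d, ∀ i, ∃ y ∈ Y, ∀ j, |block hd x i j - block hd y.1 i j| ≤ (b - a) / N := by
  let sig : (Σ i, Fin (ds i)) → Fin k := fun q => Fin.castLE (hds q.1) q.2
  -- Coordinates with the same position in their blocks share a grid index, so the list has `N ^ k`
  -- points rather than `N ^ d`.
  let pos : Fin d → Fin k := fun l => sig (finSigmaFinEquiv.symm (Fin.cast hd.symm l))
  let pt : (Fin k → Fin N) → cube a b d := fun t =>
    ⟨fun l => gridPoint a b N (t (pos l)), fun l => gridPoint_mem_Icc hab _⟩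
  refine ⟨Finset.univ.toList.map pt, by simp, fun x hx i => ?_⟩
  choose t ht using fun j => exists_abs_sub_gridPoint_le hab hN (block_mem_cube hd hx i j)
  let t' : Fin k → Fin N := fun q => if hq : q.1 < ds i then t ⟨q, hq⟩ else ⟨0, hN⟩
  refine ⟨pt t', List.mem_map.2 ⟨t', by simp, rfl⟩, fun j => ?_⟩
  have : block hd (pt t').1 i j = gridPoint a b N (t j) := by
    have hs : pos (Fin.cast hd (finSigmaFinEquiv ⟨i, j⟩)) = Fin.castLE (hds i) j :=
      congrArg sig (Equiv.symm_apply_apply finSigmaFinEquiv ⟨i, j⟩)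
    simp only [block, pt, hs, t']
    simp
  rw [this]
  exact ht j

/-- A Lipschitz parallelization is approximated, by a network of controlled size and from below,
by maxima of `ℓ_1`-cones with apexes on a grid. -/
theorem exists_net_approx_parallelization {a b : ℝ} (hab : a < b) {n d k : ℕ} {ds : Fin n → ℕ}
    (hd0 : 0 < d) (hn : 0 < n) (hd : ∑ i, ds i = d) (hds : ∀ i, ds i ≤ k) {L : ℝ} (hL : 0 ≤ L)
    (g : (i : Fin n) → cube a b (ds i) → ℝ)
    (hg : ∀ i, ∀ x y : cube a b (ds i), |g i x - g i y| ≤ L * ∑ j, |x.1 j - y.1 j|)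
    {N : ℕ} (hN : 0 < N) :
    ∃ Φ : Net d n, Φ.params = (d + (n + n)) * (d + 1) +
        (n * (d + (n + n) + 1) + N ^ k * stepParams d n) ∧
      (∀ (x : cube a b d) i,
        |Φ.realize x i - parallelization hd g x i| ≤ 2 * L * (k * ((b - a) / N))) ∧
      ∀ (x y : cube a b d) i,
        |Φ.realize x i - Φ.realize y i| ≤ L * ∑ j, |block hd x.1 i j - block hd y.1 i j| := by
  have hba : 0 < b - a := sub_pos.2 hab
  obtain ⟨Y, hYN, hY⟩ := exists_list_grid hab hd hds hN
  let e : (i : Fin n) → Fin (ds i) → Fin d := fun i j => Fin.cast hd (finSigmaFinEquiv ⟨i, j⟩)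
  have hamem : ∀ m, (fun _ => a : Fin m → ℝ) ∈ cube a b m := fun m _ => ⟨le_rfl, hab.le⟩
  -- A constant below `g i` on the whole cube, so starting the maximum there keeps it below `g i`.
  let B : Fin n → ℝ := fun i => g i ⟨fun _ => a, hamem _⟩ - L * ∑ _j : Fin (ds i), (b - a)
  have hB : ∀ i x, B i ≤ g i x := by
    intro i x
    have h1 := (abs_le.1 (hg i ⟨fun _ => a, hamem _⟩ x)).2
    have h2 : ∑ j, |a - x.1 j| ≤ ∑ _j : Fin (ds i), (b - a) := by
      refine Finset.sum_le_sum fun j _ => ?_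
      have := x.2 j
      rw [abs_le]
      constructor <;> linarith [this.1, this.2]
    have h3 := mul_le_mul_of_nonneg_left h2 hL
    simp only [B]
    linarith
  let H := Y.map fun y => (y.1, parallelization hd g y)
  obtain ⟨Φ, hΦ, hΦx⟩ := exists_net_coneMax hd0 hn e L a B H
  have hcone : ∀ (y : cube a b d) (x : Fin d → ℝ) i,
      cone e L (y.1, parallelization hd g y) x i =
        parallelization hd g y i - L * ∑ j, |block hd x i j - block hd y.1 i j| :=
    fun _ _ _ => rfl
  have hle : ∀ (x : cube a b d) i u, Φ.realize x i ≤ u ↔ B i ≤ u ∧ ∀ y ∈ Y,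
      parallelization hd g y i - L * ∑ j, |block hd x.1 i j - block hd y.1 i j| ≤ u := by
    intro x i u
    rw [hΦx x (fun l => (x.2 l).1), coneMax_le_iff]
    simp only [H, List.forall_mem_map, hcone]
  refine ⟨Φ, by simpa [H, hYN] using hΦ, fun x i => ?_, ?_⟩
  · have hup : Φ.realize x i ≤ parallelization hd g x i := by
      refine (hle x i _).2 ⟨hB i _, fun y _ => ?_⟩
      have := (abs_le.1 (hg i ⟨_, block_mem_cube hd x.2 i⟩ ⟨_, block_mem_cube hd y.2 i⟩)).1
      simp only [parallelization]
      linarith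
    -- The factor 2: moving from `x` to `y` costs once in `g i` and once in the cone at `y`.
    obtain ⟨y, hyY, hy⟩ := hY x x.2 i
    have hlow := ((hle x i _).1 le_rfl).2 y hyY
    have hgy := (abs_le.1 (hg i ⟨_, block_mem_cube hd x.2 i⟩ ⟨_, block_mem_cube hd y.2 i⟩)).2
    have hsum : ∑ j, |block hd x.1 i j - block hd y.1 i j| ≤ k * ((b - a) / N) := by
      calc _ ≤ ∑ _j : Fin (ds i), (b - a) / N := Finset.sum_le_sum fun j _ => hy j
        _ = ds i * ((b - a) / N) := by simp
        _ ≤ k * ((b - a) / N) := by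
          have : (ds i : ℝ) ≤ k := by exact_mod_cast hds i
          gcongr
    have := mul_le_mul_of_nonneg_left hsum hL
    simp only [parallelization] at hup hlow ⊢
    rw [abs_of_nonpos (by linarith)]
    linarith
  · have hone : ∀ (x y : cube a b d) i,
        Φ.realize x i ≤ Φ.realize y i + L * ∑ j, |block hd x.1 i j - block hd y.1 i j| := by
      intro x y i
      have hy := (hle y i _).1 le_rfl
      refine (hle x i _).2 ⟨?_, fun z hz => ?_⟩
      · have : 0 ≤ L * ∑ j, |block hd x.1 i j - block hd y.1 i j| := by positivity
        linarith [hy.1]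
      · have h1 := hy.2 z hz
        have h2 : ∑ j, |block hd y.1 i j - block hd z.1 i j| ≤
            ∑ j, |block hd x.1 i j - block hd y.1 i j| +
              ∑ j, |block hd x.1 i j - block hd z.1 i j| := by
          rw [← Finset.sum_add_distrib]
          refine Finset.sum_le_sum fun j _ => ?_
          rw [abs_sub_comm (block hd x.1 i j) (block hd y.1 i j)]
          exact abs_sub_le _ _ _
        have h3 := mul_le_mul_of_nonneg_left h2 hL
        linarith
    intro x y i
    have h1 := hone x y i
    have h2 := hone y x i
    simp only [abs_sub_comm (block hd y.1 i _)] at h2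
    rw [abs_le]
    constructor <;> linarith

/-! ### Parameter count and choice of the grid -/

theorem params_le {d n M : ℕ} (hd : 0 < d) (hn : n ≤ d) (hM : 0 < M) :
    (d + (n + n)) * (d + 1) + (n * (d + (n + n) + 1) + M * stepParams d n) ≤ 34 * d ^ 2 * M := by
  have h1 : (d + (n + n)) * (d + 1) ≤ (3 * d) * (2 * d) := by gcongr <;> omega
  have h2 : n * (d + (n + n) + 1) ≤ d * (4 * d) := by gcongr; omega
  have h3 : stepParams d n ≤ 24 * d ^ 2 := by
    calc stepParams d n ≤ (3 * d) * (4 * d) + (3 * d) * (4 * d) := by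
          unfold stepParams; gcongr <;> omega
      _ = 24 * d ^ 2 := by ring
  calc _ ≤ (3 * d) * (2 * d) + (d * (4 * d) + M * (24 * d ^ 2)) := by gcongr
    _ = 10 * d ^ 2 * 1 + 24 * d ^ 2 * M := by ring
    _ ≤ 10 * d ^ 2 * M + 24 * d ^ 2 * M := by gcongr; exact hM
    _ = _ := by ring

end DNN

theorem corollary3p5 (k : ℕ) (hk : 0 < k) :
    ∃ K : ℕ, 0 < K ∧
      ∀ (d : ℕ) (_ : 0 < d) (a b : ℝ) (_ : a < b) (p : ℝ≥0∞) (_ : 1 ≤ p)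
        (L : ℝ) (_ : 0 ≤ L) (ε : ℝ) (_ : 0 < ε) (_ : ε ≤ 1)
        (n : ℕ) (f : C(DNN.cube a b d, Fin n → ℝ)) (_ : f ∈ DNN.lipParallel k p a b d L n),
        (DNN.cost p f ((k : ℝ) ^ (1 - (p⁻¹).toReal) * L) ε : ℝ≥0∞) ≤
          ENNReal.ofReal
            ((K : ℝ) * (d : ℝ) ^ (2 * k + 3) * (max (L * (b - a)) 1) ^ (2 * k) *
              ε ^ (-(2 * k : ℤ))) := by
  -- `34` comes from `params_le`, `(3 * k) ^ k` from `N ≤ 3 * T`.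
  refine ⟨34 * (3 * k) ^ k, by positivity, ?_⟩
  intro d hd0 a b hab p hp L hL ε hε hε1 n f hf
  obtain ⟨hn, ds, hd, g, hds0, hds, hg, hfg⟩ := hf
  have : Fact (1 ≤ p) := ⟨hp⟩
  have hba : 0 < b - a := sub_pos.2 hab
  have hk' : (0 : ℝ) < k := by exact_mod_cast hk
  have hk1 : (1 : ℝ) ≤ k := by exact_mod_cast hk
  have hd' : (0 : ℝ) < d := by exact_mod_cast hd0
  have hd1 : (1 : ℝ) ≤ d := by exact_mod_cast hd0
  have hnd : n ≤ d := by
    calc n = ∑ _i : Fin n, 1 := by simp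
      _ ≤ ∑ i, ds i := Finset.sum_le_sum fun i _ => hds0 i
      _ = d := hd
  set Q := max (L * (b - a)) 1 with hQ
  have hQ1 : 1 ≤ Q := le_max_right _ _
  have hLQ : L * (b - a) ≤ Q := le_max_left _ _
  set T : ℝ := k * d * Q / ε with hT
  have hT1 : 1 ≤ T := by
    rw [hT, le_div_iff₀ hε]
    have : (1 : ℝ) ≤ k * d * Q := one_le_mul_of_one_le_of_one_le
      (one_le_mul_of_one_le_of_one_le hk1 hd1) hQ1
    linarith
  set N := ⌈2 * T⌉₊ with hNdef
  have hN : 0 < N := Nat.ceil_pos.2 (by linarith)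
  have hN' : (0 : ℝ) < N := by exact_mod_cast hN
  have hNle : (N : ℝ) ≤ 3 * T := by
    have := Nat.ceil_lt_add_one (a := 2 * T) (by linarith)
    linarith
  have hleN : 2 * T ≤ N := Nat.le_ceil _
  obtain ⟨Φ, hΦ, happ, hlip⟩ := DNN.exists_net_approx_parallelization hab hd0 hn hd hds hL g
    (fun i x y => (hg i x y).trans
      (mul_le_mul_of_nonneg_left (DNN.lpNorm_le_sum_abs p _) hL)) hN
  have hcost : DNN.cost p f ((k : ℝ) ^ (1 - (p⁻¹).toReal) * L) ε ≤ (Φ.params : ℕ∞) := by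
    refine sInf_le ⟨Φ, rfl, fun x => ?_, fun x y => ?_⟩
    -- At most `d` components, each with error at most `ε / d`, have `ℓ_1`-error at most `ε`.
    · have hδ : 2 * L * (k * ((b - a) / N)) ≤ ε / d := by
        have h1 : 2 * (k * d * Q) ≤ N * ε := by
          have := mul_le_mul_of_nonneg_right hleN hε.le
          rwa [hT, mul_assoc, div_mul_cancel₀ _ hε.ne'] at this
        rw [le_div_iff₀ hd']
        calc 2 * L * (k * ((b - a) / N)) * d = 2 * (k * d * (L * (b - a))) / N := by ring
          _ ≤ 2 * (k * d * Q) / N := by gcongr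
          _ ≤ ε := by rw [div_le_iff₀ hN']; linarith
      have hnd' : (n : ℝ) ≤ d := by exact_mod_cast hnd
      calc _ ≤ ∑ i, |(Φ.realize x - f x) i| := DNN.lpNorm_le_sum_abs p _
        _ ≤ ∑ _i : Fin n, ε / d := by
          refine Finset.sum_le_sum fun i _ => ?_
          rw [Pi.sub_apply, hfg]
          exact (happ x i).trans hδ
        _ = n * (ε / d) := by simp
        _ ≤ d * (ε / d) := by gcongr
        _ = ε := by field_simp
    · refine DNN.lpNorm_le_mul_lpNorm_of_block hp hd (by positivity) _ _ fun i => ?_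
      refine (hlip x y i).trans ?_
      rw [mul_comm _ L, mul_assoc]
      exact mul_le_mul_of_nonneg_left
        (DNN.sum_abs_le_rpow_mul_lpNorm p hp hk (hds i) (DNN.block hd (x.1 - y.1) i)) hL
  have hparams : (Φ.params : ℝ) ≤ ((34 * (3 * k) ^ k : ℕ) : ℝ) * (d : ℝ) ^ (2 * k + 3) *
      Q ^ (2 * k) * ε ^ (-(2 * k : ℤ)) := by
    have h1 : (Φ.params : ℝ) ≤ 34 * (d : ℝ) ^ 2 * (N : ℝ) ^ k := by
      rw [hΦ]
      exact_mod_cast DNN.params_le hd0 hnd (pow_pos hN k)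
    have hz : ε ^ (-(2 * k : ℤ)) = (ε⁻¹) ^ (2 * k) := by
      rw [zpow_neg, inv_pow, ← zpow_natCast]
      norm_num
    have hεi : 1 ≤ ε⁻¹ := (one_le_inv₀ hε).2 hε1
    rw [hz]
    calc (Φ.params : ℝ) ≤ 34 * (d : ℝ) ^ 2 * (3 * T) ^ k := h1.trans (by gcongr)
      _ = 34 * (3 * k) ^ k * (d : ℝ) ^ (k + 2) * Q ^ k * (ε⁻¹) ^ k := by
        rw [hT, div_eq_mul_inv]
        simp only [mul_pow]
        ring
      -- `d`, `Q` and `ε⁻¹` are at least 1, so the exponents may be enlarged.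
      _ ≤ 34 * (3 * k) ^ k * (d : ℝ) ^ (2 * k + 3) * Q ^ (2 * k) * (ε⁻¹) ^ (2 * k) := by
        gcongr <;> first | assumption | omega
      _ = _ := by push_cast; ring
  calc (DNN.cost p f ((k : ℝ) ^ (1 - (p⁻¹).toReal) * L) ε : ℝ≥0∞)
      ≤ ((Φ.params : ℕ∞) : ℝ≥0∞) := ENat.toENNReal_le.2 hcost
    _ = ENNReal.ofReal (Φ.params : ℝ) := by simp
    _ ≤ _ := ENNReal.ofReal_le_ofReal hparams
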